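/- Let $\mathcal H$ be a finite-dimensional complex Hilbert space. For a lower semicontinuous convex function $f:\mathbb R\to(-\infty,\infty]$ that is finite on $(0,\infty)$, let $g_f$ be the lower semicontinuous hull of the function $(\lambda_1,\lambda_2)\mapsto\lambda_2 f(\lambda_1/\lambda_2)$ (defined as $\infty$ for $\lambda_2\le 0$), and for finite measures $P_1,P_2$ with densities $p_1,p_2$ with respect to $\mu=P_1+P_2$ put $D_f(P_1\|P_2)=\int g_f(p_1,p_2)\,d\mu$. For positive operators $\rho_1,\rho_2$ on $\mathcal H$ (for example density operators) put $$D_f^{\min}(\rho_1\|\rho_2)=\sup_M D_f\big(P^M_{\rho_1}\,\big\|\,P^M_{\rho_2}\big),$$ where $M$ runs over all positive operator valued measures on measurable spaces and $P^M_\rho(B)=\mathrm{tr}\,\rho M(B)$. Let $f^*(t)=\sup_{\lambda\in\mathbb R}(t\lambda-f(\lambda))$ and $\mathrm{dom}\,f^*=\{t: f^*(t)<\infty\}$. Let $f_2(\lambda)=\lambda^2$ for $\lambda\ge 0$ and $f_2(\lambda)=0$ for $\lambda<0$; let $f_{-1}(\lambda)=1/\lambda$ for $\lambda>0$ and $f_{-1}(\lambda)=\infty$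 for $\lambda\le 0$. Assume $\mathrm{supp}\,\rho_1\subseteq\mathrm{supp}\,\rho_2$, where $\mathrm{supp}\,\rho=(\ker\rho)^\perp$. Then: 1. The integral $T_0=4\int_{-\infty}^0 e^{s\rho_2}\rho_1e^{s\rho_2}\,ds$ converges absolutely, $T_0\ge 0$, and $T_0$ solves the Lyapunov equation $\frac14(T_0\rho_2+\rho_2T_0)=\rho_1$. 2. $T_0$ maximizes $G(T)=\mathrm{tr}\,\rho_1T-\mathrm{tr}\,\rho_2f_2^*(T)$ among all self-adjoint operators $T$ on $\mathcal H$ with $\mathrm{spec}\,T\subset\mathrm{dom}\,f_2^*$ (and $T_0$ is one of them), and $D_{f_2}^{\min}(\rho_1\|\rho_2)=G(T_0)$. 3. $D_{f_{-1}}^{\min}(\rho_2\|\rho_1)=D_{f_2}^{\min}(\rho_1\|\rho_2)=\frac14\,\mathrm{tr}\,\rho_2T_0^2=\frac12\,\mathrm{tr}\,\rho_1T_0$. 4. In every orthonormal basis of eigenvectors of $\rho_2$, with the convention that terms with $\rho_{2,ii}+\rho_{2,jj}=0$ are $0$ (then also $\rho_{1,ij}=0$), one has $T_{0,ij}=\dfrac{4}{\rho_{2,ii}+\rho_{2,jj}}\,\rho_{1,ij}$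 and $$D_{f_{-1}}^{\min}(\rho_2\|\rho_1)=D_{f_2}^{\min}(\rho_1\|\rho_2)=2\sum_{i,j}\frac{|\rho_{1,ij}|^2}{\rho_{2,ii}+\rho_{2,jj}}.$$ -/

import Mathlib

open MeasureTheory

universe u v w

noncomputable section

/-! ### Convex functions with values in the extended reals -/

/-- The effective domain of an extended-real-valued function: the points where it is `< ∞`. -/
def effDom (f : ℝ → EReal) : Set ℝ := {x | f x < ⊤}

/-- The convex conjugate `f^*(t) = sup_x (t x - f x)`. -/
def convConj (f : ℝ → EReal) (t : ℝ) : EReal := ⨆ x : ℝ, ((t * x : ℝ) : EReal) - f x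

/-- The lower semicontinuous hull: the greatest lower semicontinuous function majorized by `φ`. -/
def lscHull {X : Type*} [TopologicalSpace X] (φ : X → EReal) (x : X) : EReal :=
  sSup {y | ∃ h : X → EReal, LowerSemicontinuous h ∧ (∀ z, h z ≤ φ z) ∧ y = h x}

/-- The function `(l₁, l₂) ↦ l₂ f (l₁ / l₂)`, which is `∞` where it is not defined (`l₂ ≤ 0`). -/
def perspective (f : ℝ → EReal) (l : ℝ × ℝ) : EReal :=
  if 0 < l.2 then (l.2 : EReal) * f (l.1 / l.2) else ⊤

/-- The integrand of the `f`-divergence. -/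
def divIntegrand (f : ℝ → EReal) : ℝ × ℝ → EReal := lscHull (perspective f)

/-- The functions `f_α`, for `α ≠ 0, 1`: `sign ((α - 1) α) x ^ α` for `x > 0`, its limit
(`0` or `∞`) at `x = 0`, and the canonical extension to the negative half line, which is the affine
function `f (0) + f'₊(0) x` if the right derivative `f'₊(0)` is finite (that is, if `1 < α`, where
both `f (0)` and `f'₊(0)` vanish) and `∞` otherwise. -/
def renyiFun (α : ℝ) (x : ℝ) : EReal :=
  if 0 < x then (((if 0 ≤ (α - 1) * α then 1 else -1) * x ^ α : ℝ) : EReal)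
  else if x = 0 then (if α < 0 then ⊤ else 0)
  else (if 1 < α then 0 else ⊤)

/-! ### Classical `f`-divergence -/

/-- The integral of an extended-real-valued function, as the difference of the integrals of its
positive part and of its negative part. -/
def erealIntegral {Ω : Type*} [MeasurableSpace Ω] (μ : Measure Ω) (h : Ω → EReal) : EReal :=
  ((∫⁻ x, (h x).toENNReal ∂μ : ENNReal) : EReal) - ((∫⁻ x, (-h x).toENNReal ∂μ : ENNReal) : EReal)

/-- The `f`-divergence of two finite measures, computed with their densities with respect to the
dominating measure `P₁ + P₂`. -/
def fDivergence (f : ℝ → EReal) {Ω : Type*} [MeasurableSpace Ω] (P₁ P₂ : Measure Ω) : EReal :=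
  erealIntegral (P₁ + P₂) fun x =>
    divIntegrand f ((P₁.rnDeriv (P₁ + P₂) x).toReal, (P₂.rnDeriv (P₁ + P₂) x).toReal)

/-! ### Measurements on a finite-dimensional Hilbert space -/

section Quantum

variable {H : Type u} [NormedAddCommGroup H] [InnerProductSpace ℂ H] [FiniteDimensional ℂ H]

/-- The real part of the trace. -/
def trRe (A : H →L[ℂ] H) : ℝ := (LinearMap.trace ℂ H (A : H →ₗ[ℂ] H)).re

/-- The support of a self-adjoint operator: the orthogonal complement of its kernel. -/
def opSupport (A : H →L[ℂ] H) : Submodule ℂ H := (LinearMap.ker (A : H →ₗ[ℂ] H))ᗮ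

/-- The matrix entry `A_{ij}` of an operator in an orthonormal basis. -/
def opEntry {ι : Type v} [Fintype ι] (e : OrthonormalBasis ι ℂ H) (A : H →L[ℂ] H) (i j : ι) : ℂ :=
  inner ℂ (e i) (A (e j))

theorem trRe_mul_nonneg {A B : H →L[ℂ] H} (hA : A.IsPositive) (hB : B.IsPositive) :
    0 ≤ trRe (A * B) := by
  have hA' := (ContinuousLinearMap.isPositive_toLinearMap_iff A).2 hA
  have hs := hA'.isSymmetric
  unfold trRe
  rw [LinearMap.trace_eq_sum_inner _ (hs.eigenvectorBasis rfl), Complex.re_sum]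
  refine Finset.sum_nonneg fun i _ => ?_
  have h1 : inner ℂ (hs.eigenvectorBasis rfl i)
      (((A * B : H →L[ℂ] H) : H →ₗ[ℂ] H) (hs.eigenvectorBasis rfl i))
      = (hs.eigenvalues rfl i : ℂ) *
        inner ℂ (hs.eigenvectorBasis rfl i) (B (hs.eigenvectorBasis rfl i)) := by
    have h2 := hs (hs.eigenvectorBasis rfl i) (B (hs.eigenvectorBasis rfl i))
    rw [hs.apply_eigenvectorBasis rfl i, inner_smul_left] at h2
    simpa using h2.symm
  rw [h1, Complex.re_ofReal_mul]
  exact mul_nonneg (hA'.nonneg_eigenvalues rfl i) (hB.re_inner_nonneg_right _)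

/-- The map `A ↦ tr (ρ A)` (real part), as an additive homomorphism. -/
def trHom (ρ : H →L[ℂ] H) : (H →L[ℂ] H) →+ ℝ where
  toFun A := trRe (ρ * A)
  map_zero' := by simp [trRe]
  map_add' A B := by simp [trRe, mul_add]

theorem continuous_trHom (ρ : H →L[ℂ] H) : Continuous (trHom ρ) := by
  have h : Continuous fun A : H →L[ℂ] H =>
      ∑ i, inner ℂ (stdOrthonormalBasis ℂ H i) (ρ (A (stdOrthonormalBasis ℂ H i))) := by
    fun_prop
  refine (Complex.continuous_re.comp h).congr fun A => ?_
  simp [trHom, trRe, LinearMap.trace_eq_sum_inner _ (stdOrthonormalBasis ℂ H)]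

variable (H) in
/-- A positive operator valued measure on `Ω` with values in the operators on `H`. -/
structure POVM (Ω : Type w) [MeasurableSpace Ω] where
  /-- the underlying countably additive operator valued set function -/
  toVectorMeasure : VectorMeasure Ω (H →L[ℂ] H)
  isPositive : ∀ B, MeasurableSet B → (toVectorMeasure B).IsPositive
  total : toVectorMeasure Set.univ = 1

namespace POVM

variable {Ω : Type w} [MeasurableSpace Ω]

/-- The distribution `B ↦ tr (ρ M(B))` of the outcome of the measurement `M` in the state `ρ`. -/
def outcome (M : POVM H Ω) (ρ : H →L[ℂ] H) (hρ : ρ.IsPositive) : Measure Ω :=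
  SignedMeasure.toMeasureOfZeroLE (M.toVectorMeasure.mapRange (trHom ρ) (continuous_trHom ρ))
    Set.univ MeasurableSet.univ
    ((VectorMeasure.le_restrict_univ_iff_le _ _).2 fun B hB =>
      trRe_mul_nonneg hρ (M.isPositive B hB))

theorem outcome_apply (M : POVM H Ω) (ρ : H →L[ℂ] H) (hρ : ρ.IsPositive) {B : Set Ω}
    (hB : MeasurableSet B) :
    M.outcome ρ hρ B = ENNReal.ofReal (trRe (ρ * M.toVectorMeasure B)) := by
  unfold outcome
  rw [SignedMeasure.toMeasureOfZeroLE_apply _ _ _ hB]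
  rw [← ENNReal.ofReal_coe_nnreal]
  simp only [NNReal.coe_mk, Set.univ_inter, VectorMeasure.mapRange_apply]
  rfl

end POVM

/-- The optimal measured `f`-divergence: the supremum of the `f`-divergence of the outcome
distributions over all measurements. -/
def measuredDiv (f : ℝ → EReal) (ρ₁ ρ₂ : H →L[ℂ] H) (h₁ : ρ₁.IsPositive) (h₂ : ρ₂.IsPositive) :
    EReal :=
  ⨆ (Ω : Type w) (_ : MeasurableSpace Ω) (M : POVM H Ω),
    fDivergence f (M.outcome ρ₁ h₁) (M.outcome ρ₂ h₂)

/-- The domain of the dual problem: self-adjoint `T` whose spectrum lies in `dom f^*`. -/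
def dualDomain (f : ℝ → EReal) : Set (H →L[ℂ] H) :=
  letI : CompleteSpace H := FiniteDimensional.complete ℂ H
  {T | IsSelfAdjoint T ∧ spectrum ℝ T ⊆ effDom (convConj f)}

/-- The objective `G(T) = tr (ρ₁ T) - tr (ρ₂ f^*(T))` of the dual problem, where `f^*(T)` is given
by the functional calculus. -/
def dualObjective (f : ℝ → EReal) (ρ₁ ρ₂ T : H →L[ℂ] H) : ℝ :=
  letI : CompleteSpace H := FiniteDimensional.complete ℂ H
  trRe (ρ₁ * T) - trRe (ρ₂ * cfc (fun t : ℝ => (convConj f t).toReal) T)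

/-- The integrand `s ↦ e^{sρ₂} ρ₁ e^{sρ₂}`. -/
def lyapIntegrand (ρ₁ ρ₂ : H →L[ℂ] H) (s : ℝ) : H →L[ℂ] H :=
  NormedSpace.exp ((s : ℂ) • ρ₂) * ρ₁ * NormedSpace.exp ((s : ℂ) • ρ₂)

/-- The operator `T₀ = 4 ∫_{-∞}^0 e^{sρ₂} ρ₁ e^{sρ₂} ds`. -/
def lyapOp (ρ₁ ρ₂ : H →L[ℂ] H) : H →L[ℂ] H :=
  (4 : ℂ) • ∫ s in Set.Iic (0 : ℝ), lyapIntegrand ρ₁ ρ₂ s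

end Quantum

end

/-! ### The functions `f₂` and `f₋₁` -/

/-! Both divergences have the same integrand `x²/y`, once the arguments for `f₋₁` are swapped.
`IsQuadraticKernel` keeps only what is needed: nonnegativity, the tangent bounds `t x - t² y / 4`
for `t ≥ 0`, and an upper bound phrased without division so that `y = 0` is included.

Let `T ≥ 0` solve `ρ₁ = (Tρ₂ + ρ₂T)/4`. For real `a`, positivity of `(a - T)ρ₂(a - T) = a²ρ₂ - 4aρ₁
+ Tρ₂T` gives `4a P₁ ≤ a² P₂ + Q` for the outcome measures of any measurement, `Q` belonging to
`Tρ₂T` (`POVM.outcome_le`). On densities the discriminant yields `4p₁² ≤ q p₂`, hence `p₁²/p₂ ≤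
q/4`, which integrates to at most `¼ tr ρ₂T²`. Measuring in an eigenbasis of `T` attains this bound:
there `2P₁{k} = t_k P₂{k}`, so the tangent bounds with `t = t_k` sum to the same number
(`iSup_erealIntegral_outcome_eq`).

The dual problem is a completed square: `¼ tr ρ₂T² - G(S) = ¼ tr ρ₂(S - T)² ≥ 0`. The operator `T₀`
is such a `T`: in an eigenbasis of `ρ₂` the integral acts entrywise through `∫ e^{(λᵢ+λⱼ)s} ds =
1/(λᵢ+λⱼ)`, and the support hypothesis removes the entries where this diverges. -/

theorem renyiFun_two_of_nonneg {x : ℝ} (hx : 0 ≤ x) : renyiFun 2 x = ((x ^ 2 : ℝ) : EReal) := by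
  rcases hx.lt_or_eq with hx | rfl
  · norm_num [renyiFun, hx]
  · norm_num [renyiFun]

theorem renyiFun_two_of_neg {x : ℝ} (hx : x < 0) : renyiFun 2 x = 0 := by
  norm_num [renyiFun, hx.ne, hx.le.not_gt]

theorem renyiFun_neg_one_of_pos {x : ℝ} (hx : 0 < x) :
    renyiFun (-1) x = ((x⁻¹ : ℝ) : EReal) := by
  norm_num [renyiFun, hx, Real.rpow_neg_one]

theorem renyiFun_neg_one_of_nonpos {x : ℝ} (hx : x ≤ 0) : renyiFun (-1) x = ⊤ := by
  rcases hx.lt_or_eq with hx | rfl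
  · norm_num [renyiFun, hx.ne, hx.le.not_gt]
  · norm_num [renyiFun]

theorem convConj_renyiFun_two_of_nonneg {t : ℝ} (ht : 0 ≤ t) :
    convConj (renyiFun 2) t = ((t ^ 2 / 4 : ℝ) : EReal) := by
  refine le_antisymm (iSup_le fun x => ?_) (le_iSup_of_le (t / 2) ?_)
  · rcases le_or_gt 0 x with hx | hx
    · rw [renyiFun_two_of_nonneg hx, ← EReal.coe_sub, EReal.coe_le_coe_iff]
      nlinarith [sq_nonneg (t / 2 - x)]
    · rw [renyiFun_two_of_neg hx, sub_zero, EReal.coe_le_coe_iff]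
      nlinarith [sq_nonneg t]
  · rw [renyiFun_two_of_nonneg (by positivity), ← EReal.coe_sub, EReal.coe_le_coe_iff]
    nlinarith

/-- Since `f₂` vanishes on the negative half line, `t x` is unbounded there. This is the source of
the constraint `T ≥ 0` in the dual problem. -/
theorem convConj_renyiFun_two_of_neg {t : ℝ} (ht : t < 0) : convConj (renyiFun 2) t = ⊤ := by
  refine (EReal.eq_top_iff_forall_lt _).2 fun y => ?_
  -- The witness is the point where `t x = |y| + 1`.
  have hx : -(|y| + 1) / -t < 0 := div_neg_of_neg_of_pos (by linarith [abs_nonneg y]) (by linarith)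
  refine lt_of_lt_of_le ?_ (le_iSup _ (-(|y| + 1) / -t))
  rw [renyiFun_two_of_neg hx, sub_zero, EReal.coe_lt_coe_iff]
  have : t * (-(|y| + 1) / -t) = |y| + 1 := by
    have := ht.ne
    field_simp
  linarith [le_abs_self y]

theorem effDom_convConj_renyiFun_two : effDom (convConj (renyiFun 2)) = Set.Ici 0 := by
  ext t
  rcases le_or_gt 0 t with ht | ht
  · simp [effDom, convConj_renyiFun_two_of_nonneg ht, ht]
  · simp [effDom, convConj_renyiFun_two_of_neg ht, ht]

/-! ### Lower semicontinuous hulls -/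

theorem le_lscHull {X : Type*} [TopologicalSpace X] {φ h : X → EReal}
    (hh : LowerSemicontinuous h) (hle : ∀ z, h z ≤ φ z) (x : X) : h x ≤ lscHull φ x :=
  le_sSup ⟨h, hh, hle, rfl⟩

theorem lscHull_le {X : Type*} [TopologicalSpace X] (φ : X → EReal) (x : X) :
    lscHull φ x ≤ φ x := by
  refine sSup_le ?_
  rintro _ ⟨h, -, hle, rfl⟩
  exact hle x

/-- The lower semicontinuous hull is bounded by limits of upper bounds along sequences. -/
theorem lscHull_le_of_tendsto {X : Type*} [TopologicalSpace X] {φ : X → EReal} {x : X}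
    {ι : Type*} {l : Filter ι} [l.NeBot] {z : ι → X} {c : ι → EReal} {c₀ : EReal}
    (hz : Filter.Tendsto z l (nhds x)) (hc : Filter.Tendsto c l (nhds c₀))
    (hle : ∀ᶠ i in l, φ (z i) ≤ c i) : lscHull φ x ≤ c₀ := by
  refine sSup_le ?_
  rintro _ ⟨h, hh, hφ, rfl⟩
  refine le_of_forall_lt fun y hy => ?_
  obtain ⟨y', hy', hy''⟩ := exists_between hy
  refine hy'.trans_le (ge_of_tendsto hc ?_)
  filter_upwards [hz.eventually (hh x y' hy''), hle] with i h1 h2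
  exact (h1.trans_le ((hφ _).trans h2)).le

/-! ### Divergence kernels of quadratic type -/

/-- The properties of the kernel `x ^ 2 / y` that determine the measured divergence. -/
structure IsQuadraticKernel (F : ℝ → ℝ → EReal) : Prop where
  nonneg : ∀ x y, 0 ≤ F x y
  le_of_nonneg : ∀ t x y, 0 ≤ t → ((t * x - t ^ 2 / 4 * y : ℝ) : EReal) ≤ F x y
  le_of_sq_le : ∀ x y q, 0 ≤ x → 0 ≤ y → 0 ≤ q → 4 * x ^ 2 ≤ q * y → F x y ≤ ((q / 4 : ℝ) : EReal)

theorem divIntegrand_nonneg {f : ℝ → EReal} (hf : ∀ x, 0 ≤ f x) (l : ℝ × ℝ) :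
    0 ≤ divIntegrand f l := by
  refine le_lscHull (h := fun _ => 0) lowerSemicontinuous_const (fun z => ?_) l
  unfold perspective
  split_ifs with hz
  · exact mul_nonneg (EReal.coe_nonneg.2 hz.le) (hf _)
  · exact le_top

/-- The perspective of an affine minorant is linear, hence continuous, so it competes in the
supremum defining the hull. -/
theorem le_divIntegrand_of_affine {f : ℝ → EReal} {a b : ℝ}
    (h : ∀ x : ℝ, ((a * x + b : ℝ) : EReal) ≤ f x) (x y : ℝ) :
    ((a * x + b * y : ℝ) : EReal) ≤ divIntegrand f (x, y) := by
  refine le_lscHull (h := fun z : ℝ × ℝ => ((a * z.1 + b * z.2 : ℝ) : EReal)) ?_ (fun z => ?_) (x, y)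
  · exact (continuous_coe_real_ereal.comp (by fun_prop)).lowerSemicontinuous
  · unfold perspective
    split_ifs with hz
    · have h1 := mul_le_mul_of_nonneg_left (h (z.1 / z.2)) (EReal.coe_nonneg.2 hz.le)
      rw [← EReal.coe_mul] at h1
      convert h1 using 2
      field_simp
    · exact le_top

theorem renyiFun_two_nonneg (x : ℝ) : 0 ≤ renyiFun 2 x := by
  rcases le_or_gt 0 x with hx | hx
  · rw [renyiFun_two_of_nonneg hx]
    exact EReal.coe_nonneg.2 (by positivity)
  · rw [renyiFun_two_of_neg hx]

theorem renyiFun_neg_one_nonneg (x : ℝ) : 0 ≤ renyiFun (-1) x := by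
  rcases le_or_gt x 0 with hx | hx
  · rw [renyiFun_neg_one_of_nonpos hx]
    exact le_top
  · rw [renyiFun_neg_one_of_pos hx]
    exact EReal.coe_nonneg.2 (by positivity)

theorem isQuadraticKernel_renyiFun_two :
    IsQuadraticKernel fun x y => divIntegrand (renyiFun 2) (x, y) where
  nonneg x y := divIntegrand_nonneg (fun _ => renyiFun_two_nonneg _) _
  le_of_nonneg t x y ht := by
    have := le_divIntegrand_of_affine (f := renyiFun 2) (a := t) (b := -(t ^ 2 / 4)) (fun z => ?_) x y
    · simpa [sub_eq_add_neg] using this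
    · rcases le_or_gt 0 z with hz | hz
      · rw [renyiFun_two_of_nonneg hz, EReal.coe_le_coe_iff]
        nlinarith [sq_nonneg (t / 2 - z)]
      · rw [renyiFun_two_of_neg hz, ← EReal.coe_zero, EReal.coe_le_coe_iff]
        nlinarith [sq_nonneg t]
  le_of_sq_le x y q hx hy hq h := by
    rcases hy.lt_or_eq with hy | rfl
    · refine (lscHull_le _ _).trans ?_
      rw [perspective, if_pos hy, renyiFun_two_of_nonneg (by positivity), ← EReal.coe_mul,
        EReal.coe_le_coe_iff]
      have : y * (x / y) ^ 2 = x ^ 2 / y := by field_simp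
      rw [this, div_le_iff₀ hy]
      linarith
    -- At the origin the perspective is `∞`, so the hull is bounded through the points `(0, ε)`,
    -- where the perspective vanishes.
    · have hx0 : x = 0 := by nlinarith
      subst hx0
      refine le_trans (b := 0) ?_ (EReal.coe_nonneg.2 (by positivity))
      refine lscHull_le_of_tendsto (l := nhdsWithin (0 : ℝ) (Set.Ioi 0)) (z := fun ε : ℝ => (0, ε))
        (c := fun _ => 0) ?_ tendsto_const_nhds ?_
      · exact ((Continuous.prodMk_right (0 : ℝ)).tendsto 0).mono_left nhdsWithin_le_nhds
      · filter_upwards [self_mem_nhdsWithin] with ε hε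
        have hε : 0 < ε := hε
        rw [perspective, if_pos hε]
        norm_num [renyiFun]

theorem isQuadraticKernel_renyiFun_neg_one :
    IsQuadraticKernel fun x y => divIntegrand (renyiFun (-1)) (y, x) where
  nonneg x y := divIntegrand_nonneg (fun _ => renyiFun_neg_one_nonneg _) _
  le_of_nonneg t x y ht := by
    have := le_divIntegrand_of_affine (f := renyiFun (-1)) (a := -(t ^ 2 / 4)) (b := t)
      (fun z => ?_) y x
    · refine le_trans (le_of_eq ?_) this
      congr 1
      ring
    · rcases le_or_gt z 0 with hz | hz
      · rw [renyiFun_neg_one_of_nonpos hz]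
        exact le_top
      · rw [renyiFun_neg_one_of_pos hz, EReal.coe_le_coe_iff, ← sub_nonneg]
        -- For `t > 0` the affine minorant is the tangent to `1/z` at `z = 2/t`.
        have : z⁻¹ - (-(t ^ 2 / 4) * z + t) = (1 - t * z / 2) ^ 2 / z := by
          field_simp
          ring
        rw [this]
        positivity
  le_of_sq_le x y q hx hy hq h := by
    rcases hx.lt_or_eq with hx | rfl
    · have hy' : 0 < y := by
        by_contra hy'
        have : y = 0 := by linarith
        subst this
        nlinarith [mul_pos hx hx]
      refine (lscHull_le _ _).trans ?_
      rw [perspective, if_pos hx, renyiFun_neg_one_of_pos (by positivity), ← EReal.coe_mul,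
        EReal.coe_le_coe_iff]
      have : x * (y / x)⁻¹ = x ^ 2 / y := by field_simp
      rw [this, div_le_iff₀ hy']
      linarith
    -- Approach along `(y + ε, ε)`: the shift keeps the quotient positive even for `y = 0`, and the
    -- perspective is `ε²/(y + ε) ≤ ε`.
    · refine le_trans (b := 0) ?_ (EReal.coe_nonneg.2 (by positivity))
      refine lscHull_le_of_tendsto (l := nhdsWithin (0 : ℝ) (Set.Ioi 0))
        (z := fun ε : ℝ => (y + ε, ε)) (c := fun ε : ℝ => ((ε : ℝ) : EReal)) ?_ ?_ ?_
      · have : Continuous fun ε : ℝ => (y + ε, ε) := by fun_prop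
        simpa using (this.tendsto 0).mono_left nhdsWithin_le_nhds
      · simpa using (continuous_coe_real_ereal.tendsto 0).mono_left nhdsWithin_le_nhds
      · filter_upwards [self_mem_nhdsWithin] with ε hε
        have hε : 0 < ε := hε
        rw [perspective, if_pos hε, renyiFun_neg_one_of_pos (by positivity), ← EReal.coe_mul,
          EReal.coe_le_coe_iff]
        have : ε * ((y + ε) / ε)⁻¹ = ε * (ε / (y + ε)) := by field_simp
        rw [this]
        exact mul_le_of_le_one_right hε.le ((div_le_one (by positivity)).2 (by linarith))

section Operators

variable {H : Type u} [NormedAddCommGroup H] [InnerProductSpace ℂ H]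
  {ι : Type v} [Fintype ι]

/-! ### Matrix entries of operators -/

theorem opEntry_add (e : OrthonormalBasis ι ℂ H) (A B : H →L[ℂ] H) (i j : ι) :
    opEntry e (A + B) i j = opEntry e A i j + opEntry e B i j := by
  simp [opEntry]

theorem opEntry_smul (e : OrthonormalBasis ι ℂ H) (c : ℂ) (A : H →L[ℂ] H) (i j : ι) :
    opEntry e (c • A) i j = c * opEntry e A i j := by
  simp [opEntry]

theorem eq_sum_opEntry_smul_rankOne (e : OrthonormalBasis ι ℂ H) (A : H →L[ℂ] H) :
    A = ∑ i, ∑ j, opEntry e A i j • InnerProductSpace.rankOne ℂ (e i) (e j) := by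
  ext x
  have h : A x = ∑ j, inner ℂ (e j) x • A (e j) := by
    conv_lhs => rw [← e.sum_repr' x]
    simp
  simp only [sum_apply, smul_apply,
    InnerProductSpace.rankOne_apply, opEntry]
  rw [Finset.sum_comm, h]
  refine Finset.sum_congr rfl fun j _ => ?_
  conv_lhs => rw [← e.sum_repr' (A (e j)), Finset.smul_sum]
  exact Finset.sum_congr rfl fun i _ => smul_comm _ _ _

theorem opEntry_ext (e : OrthonormalBasis ι ℂ H) {A B : H →L[ℂ] H}
    (h : ∀ i j, opEntry e A i j = opEntry e B i j) : A = B := by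
  rw [eq_sum_opEntry_smul_rankOne e A, eq_sum_opEntry_smul_rankOne e B]
  simp only [h]

theorem trace_mul_eq_sum_opEntry (e : OrthonormalBasis ι ℂ H) (A B : H →L[ℂ] H) :
    LinearMap.trace ℂ H ((A * B : H →L[ℂ] H) : H →ₗ[ℂ] H) =
      ∑ i, ∑ j, opEntry e A i j * opEntry e B j i := by
  rw [LinearMap.trace_eq_sum_inner _ e]
  refine Finset.sum_congr rfl fun i _ => ?_
  have h : A (B (e i)) = ∑ j, inner ℂ (e j) (B (e i)) • A (e j) := by
    conv_lhs => rw [← e.sum_repr' (B (e i))]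
    simp
  simp only [ContinuousLinearMap.coe_coe, mul_apply_eq_comp, h, inner_sum,
    inner_smul_right, opEntry]
  exact Finset.sum_congr rfl fun j _ => mul_comm _ _

theorem opEntry_conj (e : OrthonormalBasis ι ℂ H) {A : H →L[ℂ] H} (hA : A.IsPositive) (i j : ι) :
    opEntry e A j i = starRingEnd ℂ (opEntry e A i j) := by
  rw [opEntry, opEntry, inner_conj_symm, hA.inner_left_eq_inner_right]

theorem integrable_sum_sum_smul {α E : Type*} [MeasurableSpace α] {μ : Measure α}
    [NormedAddCommGroup E] [NormedSpace ℂ E] {c : ι → ι → α → ℂ}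
    (h : ∀ i j, Integrable (c i j) μ) (v : ι → ι → E) :
    Integrable (fun s => ∑ i, ∑ j, c i j s • v i j) μ :=
  integrable_finsetSum _ fun i _ => integrable_finsetSum _ fun j _ => (h i j).smul_const _

theorem integrableOn_of_opEntry (e : OrthonormalBasis ι ℂ H) {g : ℝ → H →L[ℂ] H} {S : Set ℝ}
    (h : ∀ i j, IntegrableOn (fun s => opEntry e (g s) i j) S) : IntegrableOn g S := by
  have hg : g = fun s => ∑ i, ∑ j, opEntry e (g s) i j •
      (InnerProductSpace.rankOne ℂ (e i) (e j) : H →L[ℂ] H) :=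
    funext fun _ => eq_sum_opEntry_smul_rankOne e _
  rw [hg]
  exact integrable_sum_sum_smul h _

/-! ### Traces -/

theorem trRe_add (A B : H →L[ℂ] H) : trRe (A + B) = trRe A + trRe B := by
  simp [trRe]

theorem trRe_sub (A B : H →L[ℂ] H) : trRe (A - B) = trRe A - trRe B := by
  simp [trRe]

theorem trRe_smul (c : ℝ) (A : H →L[ℂ] H) : trRe (c • A) = c * trRe A := by
  have : ((c • A : H →L[ℂ] H) : H →ₗ[ℂ] H) = (c : ℂ) • (A : H →ₗ[ℂ] H) := by
    ext x; simp
  simp [trRe, this]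

theorem trRe_mul_comm (A B : H →L[ℂ] H) : trRe (A * B) = trRe (B * A) := by
  unfold trRe
  exact congrArg Complex.re (LinearMap.trace_mul_comm ℂ (A : H →ₗ[ℂ] H) (B : H →ₗ[ℂ] H))

/-- Turns the linear term of `G` into the cross terms of `tr ρ₂(S - T)²`; for `S = T` it gives `tr
ρ₁T = ½ tr ρ₂T²`. -/
theorem trRe_mul_eq_of_lyapunov {ρ₁ ρ₂ T : H →L[ℂ] H}
    (h : (1 / 4 : ℝ) • (T * ρ₂ + ρ₂ * T) = ρ₁) (S : H →L[ℂ] H) :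
    trRe (ρ₁ * S) = 1 / 4 * (trRe (ρ₂ * (S * T)) + trRe (ρ₂ * (T * S))) := by
  rw [← h, smul_mul_assoc, trRe_smul, add_mul, trRe_add, mul_assoc, trRe_mul_comm T, mul_assoc,
    mul_assoc]

/-! ### The Lyapunov operator in an eigenbasis -/

/-- An eigenvalue of a positive operator at a basis vector is the diagonal entry. -/
theorem apply_eq_opEntry_smul (e : OrthonormalBasis ι ℂ H) {A : H →L[ℂ] H} {j : ι}
    (h : ∃ c : ℂ, A (e j) = c • e j) : A (e j) = opEntry e A j j • e j := by
  obtain ⟨c, hc⟩ := h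
  simp [opEntry, hc]

theorem opEntry_self_eq_ofReal (e : OrthonormalBasis ι ℂ H) {A : H →L[ℂ] H} (hA : A.IsPositive)
    (i : ι) : opEntry e A i i = ((opEntry e A i i).re : ℂ) ∧ 0 ≤ (opEntry e A i i).re := by
  have h := Complex.nonneg_iff.1 (hA.inner_nonneg_right (e i))
  exact ⟨Complex.ext rfl (by simpa [opEntry] using h.2.symm), h.1⟩

variable {ρ₁ ρ₂ : H →L[ℂ] H}

theorem isSelfAdjoint_exp_smul [CompleteSpace H] (h₂ : ρ₂.IsPositive) (s : ℝ) :
    IsSelfAdjoint (NormedSpace.exp ((s : ℂ) • ρ₂)) := by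
  refine IsSelfAdjoint.exp ?_
  rw [isSelfAdjoint_iff, star_smul, h₂.isSelfAdjoint.star_eq]
  simp

variable [FiniteDimensional ℂ H]

theorem exp_apply_of_apply_eq_smul {A : H →L[ℂ] H} {c : ℂ} {x : H} (h : A x = c • x) :
    NormedSpace.exp A x = Complex.exp c • x := by
  have : CompleteSpace H := FiniteDimensional.complete ℂ H
  have hpow : ∀ n : ℕ, (A ^ n) x = c ^ n • x := by
    intro n
    induction n with
    | zero => simp
    | succ n ih => simp [pow_succ, h, ih, smul_smul, mul_comm]
  have h1 := (NormedSpace.exp_series_hasSum_exp' (𝕂 := ℂ) A).mapL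
    (ContinuousLinearMap.apply ℂ H x)
  have h2 := (NormedSpace.exp_series_hasSum_exp' (𝕂 := ℂ) c).smul_const x
  rw [← Complex.exp_eq_exp_ℂ] at h2
  refine h1.unique (h2.congr_fun ?_)
  intro n
  simp [hpow, smul_smul]

theorem lyapIntegrand_isPositive (h₁ : ρ₁.IsPositive) (h₂ : ρ₂.IsPositive) (s : ℝ) :
    (lyapIntegrand ρ₁ ρ₂ s).IsPositive := by
  have : CompleteSpace H := FiniteDimensional.complete ℂ H
  have h := h₁.conj_adjoint (NormedSpace.exp ((s : ℂ) • ρ₂))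
  rw [(ContinuousLinearMap.isSelfAdjoint_iff'.1 (isSelfAdjoint_exp_smul h₂ s))] at h
  exact h

/-- The left exponential is self-adjoint, so it moves to the other slot of the inner product; both
exponentials then act on eigenvectors. -/
theorem opEntry_lyapIntegrand (h₂ : ρ₂.IsPositive) (e : OrthonormalBasis ι ℂ H)
    (he : ∀ i, ∃ c : ℂ, ρ₂ (e i) = c • e i) (s : ℝ) (i j : ι) :
    opEntry e (lyapIntegrand ρ₁ ρ₂ s) i j =
      Complex.exp ((opEntry e ρ₂ i i + opEntry e ρ₂ j j) * s) * opEntry e ρ₁ i j := by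
  have : CompleteSpace H := FiniteDimensional.complete ℂ H
  have hE : ∀ k, NormedSpace.exp ((s : ℂ) • ρ₂) (e k) =
      Complex.exp (s * opEntry e ρ₂ k k) • e k := fun k =>
    exp_apply_of_apply_eq_smul (by
      rw [smul_apply, apply_eq_opEntry_smul e (he k), smul_smul])
  have hs := ContinuousLinearMap.isSelfAdjoint_iff_isSymmetric.1 (isSelfAdjoint_exp_smul h₂ s)
  have hc : starRingEnd ℂ (Complex.exp (s * opEntry e ρ₂ i i)) =
      Complex.exp (s * opEntry e ρ₂ i i) := by
    rw [(opEntry_self_eq_ofReal e h₂ i).1, ← Complex.exp_conj]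
    simp
  have h3 := hs (e i) (ρ₁ (NormedSpace.exp ((s : ℂ) • ρ₂) (e j)))
  simp only [ContinuousLinearMap.coe_coe] at h3
  rw [opEntry, lyapIntegrand, mul_apply_eq_comp, mul_apply_eq_comp, ← h3,
    hE, hE, map_smul, inner_smul_left, inner_smul_right, hc, add_mul, Complex.exp_add,
    mul_comm (s : ℂ), mul_comm (s : ℂ), mul_assoc]
  rfl

/-- The entries of `ρ₁` vanish where the eigenvalues of `ρ₂` do. -/
theorem opEntry_eq_zero_of_support_le (h₂ : ρ₂.IsPositive)
    (hsupp : opSupport ρ₁ ≤ opSupport ρ₂) (e : OrthonormalBasis ι ℂ H)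
    (he : ∀ i, ∃ c : ℂ, ρ₂ (e i) = c • e i) {i j : ι}
    (h : opEntry e ρ₂ i i + opEntry e ρ₂ j j = 0) : opEntry e ρ₁ i j = 0 := by
  have hker := Submodule.orthogonal_le hsupp
  rw [opSupport, opSupport, Submodule.orthogonal_orthogonal, Submodule.orthogonal_orthogonal]
    at hker
  have hj : opEntry e ρ₂ j j = 0 := by
    have hi' := opEntry_self_eq_ofReal e h₂ i
    have hj' := opEntry_self_eq_ofReal e h₂ j
    have := congrArg Complex.re h
    simp only [Complex.add_re, Complex.zero_re] at this
    rw [hj'.1, show (opEntry e ρ₂ j j).re = 0 by linarith [hi'.2, hj'.2], Complex.ofReal_zero]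
  have h0 : ρ₂ (e j) = 0 := by rw [apply_eq_opEntry_smul e (he j), hj, zero_smul]
  have h1 : ρ₁ (e j) = 0 := hker (show e j ∈ LinearMap.ker (ρ₂ : H →ₗ[ℂ] H) from h0)
  simp [opEntry, h1]

theorem integrableOn_opEntry_lyapIntegrand (h₂ : ρ₂.IsPositive)
    (hsupp : opSupport ρ₁ ≤ opSupport ρ₂) (e : OrthonormalBasis ι ℂ H)
    (he : ∀ i, ∃ c : ℂ, ρ₂ (e i) = c • e i) (i j : ι) :
    IntegrableOn (fun s => opEntry e (lyapIntegrand ρ₁ ρ₂ s) i j) (Set.Iic (0 : ℝ)) ∧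
    ∫ s in Set.Iic (0 : ℝ), opEntry e (lyapIntegrand ρ₁ ρ₂ s) i j =
      opEntry e ρ₁ i j / (opEntry e ρ₂ i i + opEntry e ρ₂ j j) := by
  simp only [opEntry_lyapIntegrand h₂ e he]
  by_cases h : opEntry e ρ₂ i i + opEntry e ρ₂ j j = 0
  -- The integrand is identically zero, which matches division by zero having value `0`.
  · simp [opEntry_eq_zero_of_support_le h₂ hsupp e he h]
  · have hi := opEntry_self_eq_ofReal e h₂ i
    have hj := opEntry_self_eq_ofReal e h₂ j
    have hpos : 0 < (opEntry e ρ₂ i i + opEntry e ρ₂ j j).re := by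
      refine lt_of_le_of_ne (by simpa using add_nonneg hi.2 hj.2) fun h0 => h ?_
      rw [hi.1, hj.1, ← Complex.ofReal_add, ← Complex.add_re, ← h0, Complex.ofReal_zero]
    refine ⟨(integrableOn_exp_mul_complex_Iic hpos 0).mul_const _, ?_⟩
    rw [integral_mul_const, integral_exp_mul_complex_Iic hpos]
    simp [div_eq_inv_mul]

theorem exists_eigenbasis (h₂ : ρ₂.IsPositive) :
    ∃ e : OrthonormalBasis (Fin (Module.finrank ℂ H)) ℂ H, ∀ i, ∃ c : ℂ, ρ₂ (e i) = c • e i :=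
  have hs := ((ContinuousLinearMap.isPositive_toLinearMap_iff ρ₂).2 h₂).isSymmetric
  ⟨hs.eigenvectorBasis rfl, fun i => ⟨_, hs.apply_eigenvectorBasis rfl i⟩⟩

theorem integrableOn_lyapIntegrand (h₂ : ρ₂.IsPositive)
    (hsupp : opSupport ρ₁ ≤ opSupport ρ₂) :
    IntegrableOn (lyapIntegrand ρ₁ ρ₂) (Set.Iic (0 : ℝ)) := by
  obtain ⟨e, he⟩ := exists_eigenbasis h₂
  exact integrableOn_of_opEntry e fun i j =>
    (integrableOn_opEntry_lyapIntegrand h₂ hsupp e he i j).1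

theorem inner_lyapOp (h₂ : ρ₂.IsPositive)
    (hsupp : opSupport ρ₁ ≤ opSupport ρ₂) (x y : H) :
    inner ℂ x (lyapOp ρ₁ ρ₂ y) =
      4 * ∫ s in Set.Iic (0 : ℝ), inner ℂ x (lyapIntegrand ρ₁ ρ₂ s y) := by
  have : CompleteSpace H := FiniteDimensional.complete ℂ H
  have h := ((innerSL ℂ x).comp (ContinuousLinearMap.apply ℂ H y)).integral_comp_comm
    (integrableOn_lyapIntegrand h₂ hsupp)
  simp only [ContinuousLinearMap.comp_apply, ContinuousLinearMap.apply_apply,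
    innerSL_apply_apply] at h
  rw [lyapOp, smul_apply, inner_smul_right, h]

theorem opEntry_lyapOp (h₂ : ρ₂.IsPositive)
    (hsupp : opSupport ρ₁ ≤ opSupport ρ₂) (e : OrthonormalBasis ι ℂ H)
    (he : ∀ i, ∃ c : ℂ, ρ₂ (e i) = c • e i) (i j : ι) :
    opEntry e (lyapOp ρ₁ ρ₂) i j =
      4 / (opEntry e ρ₂ i i + opEntry e ρ₂ j j) * opEntry e ρ₁ i j := by
  rw [opEntry, inner_lyapOp h₂ hsupp]
  have := (integrableOn_opEntry_lyapIntegrand h₂ hsupp e he i j).2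
  simp only [opEntry] at this ⊢
  rw [this]
  ring

theorem lyapOp_isPositive (h₁ : ρ₁.IsPositive) (h₂ : ρ₂.IsPositive)
    (hsupp : opSupport ρ₁ ≤ opSupport ρ₂) : (lyapOp ρ₁ ρ₂).IsPositive := by
  rw [ContinuousLinearMap.isPositive_iff_complex]
  intro x
  have hint := inner_lyapOp h₂ hsupp x x
  have hre : ∀ s, inner ℂ x (lyapIntegrand ρ₁ ρ₂ s x) =
      (((inner ℂ x (lyapIntegrand ρ₁ ρ₂ s x)).re : ℝ) : ℂ) := fun s =>
    Complex.ext rfl (by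
      simpa using (Complex.nonneg_iff.1
        ((lyapIntegrand_isPositive h₁ h₂ s).inner_nonneg_right x)).2.symm)
  have hnn : 0 ≤ ∫ s in Set.Iic (0 : ℝ), (inner ℂ x (lyapIntegrand ρ₁ ρ₂ s x)).re :=
    integral_nonneg fun s => (lyapIntegrand_isPositive h₁ h₂ s).re_inner_nonneg_right x
  have hval : inner ℂ x (lyapOp ρ₁ ρ₂ x) =
      ((4 * ∫ s in Set.Iic (0 : ℝ), (inner ℂ x (lyapIntegrand ρ₁ ρ₂ s x)).re : ℝ) : ℂ) := by
    rw [hint, Complex.ofReal_mul, ← integral_complex_ofReal]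
    congr 1
    exact integral_congr_ae (Filter.Eventually.of_forall fun s => hre s)
  rw [← inner_conj_symm, hval, Complex.conj_ofReal]
  exact ⟨rfl, mul_nonneg zero_le_four hnn⟩

theorem lyapOp_lyapunov (h₂ : ρ₂.IsPositive)
    (hsupp : opSupport ρ₁ ≤ opSupport ρ₂) :
    (1 / 4 : ℂ) • (lyapOp ρ₁ ρ₂ * ρ₂ + ρ₂ * lyapOp ρ₁ ρ₂) = ρ₁ := by
  obtain ⟨e, he⟩ := exists_eigenbasis h₂
  refine opEntry_ext e fun i j => ?_
  have hl : opEntry e (lyapOp ρ₁ ρ₂ * ρ₂) i j =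
      opEntry e ρ₂ j j * opEntry e (lyapOp ρ₁ ρ₂) i j := by
    rw [opEntry, mul_apply_eq_comp, apply_eq_opEntry_smul e (he j), map_smul,
      inner_smul_right]
    rfl
  have hr : opEntry e (ρ₂ * lyapOp ρ₁ ρ₂) i j =
      opEntry e ρ₂ i i * opEntry e (lyapOp ρ₁ ρ₂) i j := by
    rw [opEntry, mul_apply_eq_comp, ← h₂.inner_left_eq_inner_right,
      apply_eq_opEntry_smul e (he i), inner_smul_left, ← opEntry_conj e h₂]
    rfl
  rw [opEntry_smul, opEntry_add, hl, hr, opEntry_lyapOp h₂ hsupp e he]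
  by_cases h : opEntry e ρ₂ i i + opEntry e ρ₂ j j = 0
  · simp [opEntry_eq_zero_of_support_le h₂ hsupp e he h]
  · field_simp
    ring

theorem trRe_mul_lyapOp_eq_sum (h₁ : ρ₁.IsPositive) (h₂ : ρ₂.IsPositive)
    (hsupp : opSupport ρ₁ ≤ opSupport ρ₂) (e : OrthonormalBasis ι ℂ H)
    (he : ∀ i, ∃ c : ℂ, ρ₂ (e i) = c • e i) :
    1 / 2 * trRe (ρ₁ * lyapOp ρ₁ ρ₂) = 2 * ∑ i, ∑ j, ‖opEntry e ρ₁ i j‖ ^ 2 /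
          ((opEntry e ρ₂ i i).re + (opEntry e ρ₂ j j).re) := by
  rw [trRe, trace_mul_eq_sum_opEntry e, Complex.re_sum, Finset.mul_sum, Finset.mul_sum]
  refine Finset.sum_congr rfl fun i _ => ?_
  rw [Complex.re_sum, Finset.mul_sum, Finset.mul_sum]
  refine Finset.sum_congr rfl fun j _ => ?_
  have : opEntry e ρ₁ i j * opEntry e (lyapOp ρ₁ ρ₂) j i =
      ((4 * (‖opEntry e ρ₁ i j‖ ^ 2 /
          ((opEntry e ρ₂ i i).re + (opEntry e ρ₂ j j).re)) : ℝ) : ℂ) := by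
    rw [opEntry_lyapOp h₂ hsupp e he, opEntry_conj e h₁ i j, mul_left_comm, Complex.mul_conj,
      Complex.normSq_eq_norm_sq, (opEntry_self_eq_ofReal e h₂ i).1,
      (opEntry_self_eq_ofReal e h₂ j).1]
    push_cast
    simp only [Complex.ofReal_re]
    rw [add_comm]
    ring
  rw [this, Complex.ofReal_re]
  ring

/-! ### The dual problem for `f₂` -/

theorem mem_dualDomain_renyiFun_two [CompleteSpace H] {T : H →L[ℂ] H} :
    T ∈ dualDomain (renyiFun 2) ↔ IsSelfAdjoint T ∧ spectrum ℝ T ⊆ Set.Ici 0 := by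
  rw [dualDomain, effDom_convConj_renyiFun_two]
  rfl

theorem dualObjective_renyiFun_two {T : H →L[ℂ] H} (hT : T ∈ dualDomain (renyiFun 2)) :
    dualObjective (renyiFun 2) ρ₁ ρ₂ T = trRe (ρ₁ * T) - 1 / 4 * trRe (ρ₂ * T ^ 2) := by
  have : CompleteSpace H := FiniteDimensional.complete ℂ H
  have hT' := mem_dualDomain_renyiFun_two.1 hT
  have h : cfc (fun t : ℝ => (convConj (renyiFun 2) t).toReal) T = (1 / 4 : ℝ) • T ^ 2 := by
    have h1 : cfc (fun t : ℝ => (convConj (renyiFun 2) t).toReal) T =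
        cfc (fun t : ℝ => (1 / 4 : ℝ) • t ^ 2) T := by
      -- The two functions need to agree only on the spectrum, which lies in `[0, ∞)`, where the
      -- conjugate is finite.
      refine cfc_congr fun t ht => ?_
      rw [convConj_renyiFun_two_of_nonneg (hT'.2 ht), EReal.toReal_coe, smul_eq_mul]
      ring
    rw [h1, cfc_smul (1 / 4 : ℝ) (fun t : ℝ => t ^ 2) T, cfc_pow_id (R := ℝ) T 2 hT'.1]
  unfold dualObjective
  rw [h, mul_smul_comm, trRe_smul]

theorem mem_dualDomain_of_isPositive {T : H →L[ℂ] H} (hT : T.IsPositive) :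
    T ∈ dualDomain (renyiFun 2) := by
  have : CompleteSpace H := FiniteDimensional.complete ℂ H
  exact mem_dualDomain_renyiFun_two.2 ⟨hT.isSelfAdjoint, fun t ht =>
    spectrum_nonneg_of_nonneg ((ContinuousLinearMap.nonneg_iff_isPositive T).2 hT) ht⟩

end Operators

/-! ### Classical divergences with quadratic kernels -/

section Classical

variable {Ω : Type w} [MeasurableSpace Ω]

theorem erealIntegral_of_nonneg {μ : Measure Ω} {h : Ω → EReal} (hh : ∀ x, 0 ≤ h x) :
    erealIntegral μ h = ((∫⁻ x, (h x).toENNReal ∂μ : ENNReal) : EReal) := by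
  have : ∀ x, (-h x).toENNReal = 0 := fun x =>
    EReal.toENNReal_of_nonpos (by simpa using EReal.neg_le_neg_iff.2 (hh x))
  simp [erealIntegral, this]

theorem rnDeriv_le_rnDeriv_of_le {ν ν' : Measure Ω} (μ : Measure Ω) [IsFiniteMeasure μ]
    [IsFiniteMeasure ν] [IsFiniteMeasure ν'] (h : ν ≤ ν') :
    ν.rnDeriv μ ≤ᵐ[μ] ν'.rnDeriv μ := by
  have h1 := Measure.rnDeriv_add ν (ν' - ν) μ
  rw [add_comm, Measure.sub_add_cancel_of_le h] at h1
  filter_upwards [h1] with x hx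
  rw [hx]
  exact le_self_add

/-- The quadratic `y a² - 4x a + q` is trivially nonnegative for `a ≤ 0`, and by density and
continuity for all real `a`; its discriminant is therefore nonpositive. -/
theorem four_mul_sq_le_of_forall_rat {x y q : ℝ} (hx : 0 ≤ x) (hy : 0 ≤ y) (hq : 0 ≤ q)
    (h : ∀ a : ℚ, 0 < a → 4 * a * x ≤ a ^ 2 * y + q) : 4 * x ^ 2 ≤ q * y := by
  have hrat : ∀ a : ℚ, 0 ≤ y * ((a : ℝ) * a) + (-4 * x) * a + q := by
    intro a
    rcases le_or_gt a 0 with ha | ha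
    · have ha' : (a : ℝ) ≤ 0 := by exact_mod_cast ha
      nlinarith [mul_nonneg hy (mul_self_nonneg (a : ℝ)), mul_nonneg hx (neg_nonneg.2 ha')]
    · nlinarith [h a ha]
  have hreal : ∀ a : ℝ, 0 ≤ y * (a * a) + (-4 * x) * a + q := fun a =>
    Rat.denseRange_cast.induction_on (p := fun a : ℝ => 0 ≤ y * (a * a) + (-4 * x) * a + q) a
      (isClosed_le continuous_const (by fun_prop)) hrat
  have := discrim_le_zero hreal
  unfold discrim at this
  nlinarith

/-- Densities inherit the Cauchy-Schwarz inequality from measures. -/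
theorem ae_four_mul_sq_rnDeriv_le {P₁ P₂ Q : Measure Ω} (μ : Measure Ω) [IsFiniteMeasure μ]
    [IsFiniteMeasure P₁] [IsFiniteMeasure P₂] [IsFiniteMeasure Q]
    (h : ∀ a : NNReal, (4 * a) • P₁ ≤ a ^ 2 • P₂ + Q) :
    ∀ᵐ x ∂μ, 4 * (P₁.rnDeriv μ x).toReal ^ 2 ≤
      (Q.rnDeriv μ x).toReal * (P₂.rnDeriv μ x).toReal := by
  -- Restricting to rational `a` leaves countably many exceptional null sets.
  have hrat : ∀ᵐ x ∂μ, ∀ a : ℚ, 0 < a → 4 * a * (P₁.rnDeriv μ x).toReal ≤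
      a ^ 2 * (P₂.rnDeriv μ x).toReal + (Q.rnDeriv μ x).toReal := by
    refine ae_all_iff.2 fun a => ?_
    set b : NNReal := (a : ℝ).toNNReal with hb
    filter_upwards [rnDeriv_le_rnDeriv_of_le μ (h b), Measure.rnDeriv_smul_left P₁ μ (4 * b),
      Measure.rnDeriv_add (b ^ 2 • P₂) Q μ, Measure.rnDeriv_smul_left P₂ μ (b ^ 2),
      Measure.rnDeriv_lt_top P₁ μ, Measure.rnDeriv_lt_top P₂ μ, Measure.rnDeriv_lt_top Q μ]
      with x hx h1 h2 h3 f1 f2 f3 ha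
    have hba : (b : ℝ) = a := Real.coe_toNNReal _ (by exact_mod_cast ha.le)
    rw [h1, h2, Pi.add_apply, h3, Pi.smul_apply, Pi.smul_apply, ENNReal.smul_def, ENNReal.smul_def,
      smul_eq_mul, smul_eq_mul] at hx
    have hfin : (↑(b ^ 2) : ENNReal) * P₂.rnDeriv μ x ≠ ⊤ :=
      ENNReal.mul_ne_top ENNReal.coe_ne_top f2.ne
    have := ENNReal.toReal_mono (ENNReal.add_ne_top.2 ⟨hfin, f3.ne⟩) hx
    rw [ENNReal.toReal_add hfin f3.ne] at this
    simpa [hba] using this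
  filter_upwards [hrat] with x hx
  exact four_mul_sq_le_of_forall_rat ENNReal.toReal_nonneg ENNReal.toReal_nonneg
    ENNReal.toReal_nonneg hx

theorem IsQuadraticKernel.erealIntegral_le {F : ℝ → ℝ → EReal} (hF : IsQuadraticKernel F)
    {P₁ P₂ Q : Measure Ω} (μ : Measure Ω) [IsFiniteMeasure μ]
    [IsFiniteMeasure P₁] [IsFiniteMeasure P₂] [IsFiniteMeasure Q]
    (h : ∀ a : NNReal, (4 * a) • P₁ ≤ a ^ 2 • P₂ + Q) :
    erealIntegral μ (fun x => F (P₁.rnDeriv μ x).toReal (P₂.rnDeriv μ x).toReal) ≤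
      ((Q.real Set.univ / 4 : ℝ) : EReal) := by
  rw [erealIntegral_of_nonneg fun x => hF.nonneg _ _]
  have hle : ∫⁻ x, (F (P₁.rnDeriv μ x).toReal (P₂.rnDeriv μ x).toReal).toENNReal ∂μ ≤
      ∫⁻ x, ENNReal.ofReal (1 / 4) * Q.rnDeriv μ x ∂μ := by
    refine lintegral_mono_ae ?_
    filter_upwards [ae_four_mul_sq_rnDeriv_le μ h, Measure.rnDeriv_lt_top Q μ] with x hx hq
    have h1 := EReal.toENNReal_le_toENNReal (hF.le_of_sq_le _ _ _ ENNReal.toReal_nonneg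
      ENNReal.toReal_nonneg ENNReal.toReal_nonneg hx)
    refine h1.trans_eq ?_
    rw [EReal.toENNReal_of_ne_top (EReal.coe_ne_top _), EReal.toReal_coe, div_eq_inv_mul,
      ENNReal.ofReal_mul (by norm_num), ENNReal.ofReal_toReal hq.ne, one_div]
  rw [lintegral_const_mul _ (Measure.measurable_rnDeriv _ _)] at hle
  -- An inequality suffices here, so `Q` need not be absolutely continuous with respect to `μ`.
  have hle' := hle.trans (mul_le_mul_right (Measure.lintegral_rnDeriv_le (μ := Q) (ν := μ)) _)
  rw [← ofReal_measureReal, ← ENNReal.ofReal_mul (by norm_num)] at hle'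
  refine (EReal.coe_ennreal_le_coe_ennreal_iff.2 hle').trans_eq ?_
  rw [EReal.coe_ennreal_ofReal, max_eq_left (by positivity)]
  congr 1
  ring

theorem rnDeriv_mul_measure_singleton [MeasurableSingletonClass Ω] {P μ : Measure Ω}
    [IsFiniteMeasure μ] [IsFiniteMeasure P] (h : P ≪ μ) (x : Ω) :
    (P.rnDeriv μ x).toReal * μ.real {x} = P.real {x} := by
  have := Measure.setLIntegral_rnDeriv h {x}
  rw [lintegral_singleton] at this
  rw [Measure.real, Measure.real, ← this, ENNReal.toReal_mul]

/-- At each atom the tangent bound reads `t P₁ - t² P₂ / 4`, which equals `t² P₂ / 4` when `2P₁ = t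
P₂`. -/
theorem IsQuadraticKernel.le_erealIntegral {F : ℝ → ℝ → EReal} (hF : IsQuadraticKernel F)
    [Fintype Ω] [MeasurableSingletonClass Ω]
    {P₁ P₂ μ : Measure Ω} [IsFiniteMeasure μ]
    [IsFiniteMeasure P₁] [IsFiniteMeasure P₂] (h₁ : P₁ ≪ μ) (h₂ : P₂ ≪ μ) {t : Ω → ℝ}
    (ht : ∀ x, 0 ≤ t x) (h : ∀ x, 2 * P₁.real {x} = t x * P₂.real {x}) :
    ((∑ x, t x ^ 2 / 4 * P₂.real {x} : ℝ) : EReal) ≤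
      erealIntegral μ (fun x => F (P₁.rnDeriv μ x).toReal (P₂.rnDeriv μ x).toReal) := by
  rw [erealIntegral_of_nonneg fun x => hF.nonneg _ _, lintegral_fintype]
  have hle : ∀ x, ENNReal.ofReal (t x ^ 2 / 4 * P₂.real {x}) ≤
      (F (P₁.rnDeriv μ x).toReal (P₂.rnDeriv μ x).toReal).toENNReal * μ {x} := by
    intro x
    have h1 := EReal.toENNReal_le_toENNReal (hF.le_of_nonneg (t x) (P₁.rnDeriv μ x).toReal
      (P₂.rnDeriv μ x).toReal (ht x))
    rw [EReal.toENNReal_of_ne_top (EReal.coe_ne_top _), EReal.toReal_coe] at h1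
    refine le_trans (le_of_eq ?_) (mul_le_mul_left h1 (μ {x}))
    rw [← ofReal_measureReal, ← ENNReal.ofReal_mul' measureReal_nonneg, sub_mul, mul_assoc,
      mul_assoc, rnDeriv_mul_measure_singleton h₁, rnDeriv_mul_measure_singleton h₂]
    congr 1
    linear_combination -(t x / 2) * h x
  have hsum := Finset.sum_le_sum fun x (_ : x ∈ Finset.univ) => hle x
  rw [← ENNReal.ofReal_sum_of_nonneg fun x _ => by positivity] at hsum
  refine le_trans ?_ (EReal.coe_ennreal_le_coe_ennreal_iff.2 hsum)
  rw [EReal.coe_ennreal_ofReal]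
  exact EReal.coe_le_coe_iff.2 (le_max_left _ _)

end Classical

/-! ### Measurements -/

section Measurements

variable {H : Type u} [NormedAddCommGroup H] [InnerProductSpace ℂ H] [FiniteDimensional ℂ H]
  {Ω : Type w} [MeasurableSpace Ω]

instance POVM.isFiniteMeasure_outcome (M : POVM H Ω) (ρ : H →L[ℂ] H) (hρ : ρ.IsPositive) :
    IsFiniteMeasure (M.outcome ρ hρ) :=
  ⟨by rw [M.outcome_apply ρ hρ MeasurableSet.univ]; exact ENNReal.ofReal_lt_top⟩

theorem POVM.outcome_real_apply (M : POVM H Ω) (ρ : H →L[ℂ] H) (hρ : ρ.IsPositive) {B : Set Ω}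
    (hB : MeasurableSet B) : (M.outcome ρ hρ).real B = trRe (ρ * M.toVectorMeasure B) := by
  rw [Measure.real, M.outcome_apply ρ hρ hB,
    ENNReal.toReal_ofReal (trRe_mul_nonneg hρ (M.isPositive B hB))]

theorem isPositive_mul_mul {A S : H →L[ℂ] H} (hA : A.IsPositive)
    (hS : S.IsPositive) :
    (S * A * S).IsPositive := by
  have : CompleteSpace H := FiniteDimensional.complete ℂ H
  have h := hA.conj_adjoint S
  rwa [ContinuousLinearMap.isSelfAdjoint_iff'.1 hS.isSelfAdjoint] at h

variable {ρ₁ ρ₂ T : H →L[ℂ] H}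

/-- An operator Cauchy-Schwarz inequality: the trace of `(a - T)ρ₂(a - T) ≥ 0` against `M(B)`, whose
cross terms are `4aρ₁` by the Lyapunov equation. -/
theorem POVM.outcome_le (M : POVM H Ω) (h₁ : ρ₁.IsPositive) (h₂ : ρ₂.IsPositive)
    (hT : T.IsPositive) (hQ : (T * ρ₂ * T).IsPositive)
    (h : (1 / 4 : ℝ) • (T * ρ₂ + ρ₂ * T) = ρ₁) (a : NNReal) :
    (4 * a) • M.outcome ρ₁ h₁ ≤ a ^ 2 • M.outcome ρ₂ h₂ + M.outcome (T * ρ₂ * T) hQ := by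
  have : CompleteSpace H := FiniteDimensional.complete ℂ H
  refine Measure.le_iff.2 fun B hB => ?_
  have hS : IsSelfAdjoint ((a : ℝ) • (1 : H →L[ℂ] H) - T) :=
    ((IsSelfAdjoint.all (a : ℝ)).smul (IsSelfAdjoint.one _)).sub hT.isSelfAdjoint
  have hpos := h₂.conj_adjoint ((a : ℝ) • (1 : H →L[ℂ] H) - T)
  rw [ContinuousLinearMap.isSelfAdjoint_iff'.1 hS] at hpos
  have hnn := trRe_mul_nonneg hpos (M.isPositive B hB)
  have hexp : (((a : ℝ) • (1 : H →L[ℂ] H) - T) ∘L ρ₂ ∘L ((a : ℝ) • (1 : H →L[ℂ] H) - T)) =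
      (a : ℝ) ^ 2 • ρ₂ + T * ρ₂ * T - (4 * (a : ℝ)) • ρ₁ := by
    rw [← h]
    change ((a : ℝ) • (1 : H →L[ℂ] H) - T) * (ρ₂ * ((a : ℝ) • (1 : H →L[ℂ] H) - T)) = _
    simp only [sub_mul, mul_sub, smul_mul_assoc, mul_smul_comm, one_mul, mul_one, mul_assoc]
    module
  rw [hexp, sub_mul, add_mul, trRe_sub, trRe_add, smul_mul_assoc, smul_mul_assoc, trRe_smul,
    trRe_smul, ← M.outcome_real_apply ρ₁ h₁ hB, ← M.outcome_real_apply ρ₂ h₂ hB,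
    ← M.outcome_real_apply _ hQ hB] at hnn
  simp only [Measure.smul_apply, Measure.add_apply, ENNReal.smul_def, smul_eq_mul]
  rw [← ofReal_measureReal, ← ofReal_measureReal, ← ofReal_measureReal,
    ← ENNReal.ofReal_coe_nnreal, ← ENNReal.ofReal_coe_nnreal,
    ← ENNReal.ofReal_mul (by positivity), ← ENNReal.ofReal_mul (by positivity),
    ← ENNReal.ofReal_add (by positivity) (by positivity)]
  refine ENNReal.ofReal_le_ofReal ?_
  push_cast
  linarith

/-- The measurement in an orthonormal basis. -/
noncomputable def basisPOVM [Fintype Ω] (e : OrthonormalBasis Ω ℂ H) : POVM H Ω where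
  toVectorMeasure := ∑ k, VectorMeasure.dirac k (InnerProductSpace.rankOne ℂ (e k) (e k))
  isPositive B hB := by
    rw [sum_apply]
    refine ContinuousLinearMap.isPositive_sum _ fun k _ => ?_
    by_cases hk : k ∈ B
    · rw [VectorMeasure.dirac_apply_of_mem hB hk]
      exact InnerProductSpace.isPositive_rankOne_self _
    · rw [VectorMeasure.dirac_apply_of_notMem hk]
      exact ContinuousLinearMap.isPositive_zero
  total := by
    rw [sum_apply]
    ext x
    simp only [VectorMeasure.dirac_apply_of_mem MeasurableSet.univ (Set.mem_univ _), sum_apply,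
      InnerProductSpace.rankOne_apply]
    exact e.sum_repr' x

theorem basisPOVM_singleton [Fintype Ω] [MeasurableSingletonClass Ω] (e : OrthonormalBasis Ω ℂ H)
    (k : Ω) :
    (basisPOVM e).toVectorMeasure {k} = InnerProductSpace.rankOne ℂ (e k) (e k) := by
  change (∑ i, VectorMeasure.dirac i (InnerProductSpace.rankOne ℂ (e i) (e i))) {k} = _
  rw [sum_apply, Finset.sum_eq_single k]
  · exact VectorMeasure.dirac_apply_of_mem (measurableSet_singleton k) rfl
  · exact fun i _ hi => VectorMeasure.dirac_apply_of_notMem hi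
  · simp

theorem outcome_basisPOVM_real_singleton [Fintype Ω] [MeasurableSingletonClass Ω]
    (e : OrthonormalBasis Ω ℂ H) (h₁ : ρ₁.IsPositive) (k : Ω) :
    ((basisPOVM e).outcome ρ₁ h₁).real {k} = (opEntry e ρ₁ k k).re := by
  classical
  rw [POVM.outcome_real_apply _ _ _ (measurableSet_singleton k), basisPOVM_singleton, trRe,
    LinearMap.trace_eq_sum_inner _ e, Finset.sum_eq_single k]
  · simp [opEntry]
  · intro i _ hi
    simp [e.inner_eq_ite, hi.symm]
  · simp

/-- For a divergence kernel of quadratic type, the supremum over all measurements is attained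
by measuring the solution of the Lyapunov equation. -/
theorem iSup_erealIntegral_outcome_eq {F : ℝ → ℝ → EReal} (hF : IsQuadraticKernel F)
    (h₁ : ρ₁.IsPositive) (h₂ : ρ₂.IsPositive) (hT : T.IsPositive)
    (h : (1 / 4 : ℝ) • (T * ρ₂ + ρ₂ * T) = ρ₁) :
    (⨆ (Ω : Type w) (_ : MeasurableSpace Ω) (M : POVM H Ω),
      erealIntegral (M.outcome ρ₁ h₁ + M.outcome ρ₂ h₂) fun x =>
        F ((M.outcome ρ₁ h₁).rnDeriv (M.outcome ρ₁ h₁ + M.outcome ρ₂ h₂) x).toReal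
          ((M.outcome ρ₂ h₂).rnDeriv (M.outcome ρ₁ h₁ + M.outcome ρ₂ h₂) x).toReal) =
      ((1 / 4 * trRe (ρ₂ * T ^ 2) : ℝ) : EReal) := by
  refine le_antisymm (iSup_le fun Ω => iSup_le fun _ => iSup_le fun M => ?_) ?_
  · have hQ := isPositive_mul_mul h₂ hT
    refine (hF.erealIntegral_le _ (M.outcome_le h₁ h₂ hT hQ h)).trans_eq ?_
    rw [M.outcome_real_apply _ hQ MeasurableSet.univ, M.total, mul_one, mul_assoc, trRe_mul_comm,
      pow_two, mul_assoc]
    congr 1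
    ring
  · obtain ⟨e', he'⟩ := exists_eigenbasis hT
    -- The lift puts the outcome space into the universe over which the supremum ranges.
    let e : OrthonormalBasis (ULift.{w} (Fin (Module.finrank ℂ H))) ℂ H :=
      e'.reindex Equiv.ulift.symm
    have he : ∀ k, T (e k) = ((opEntry e T k k).re : ℂ) • e k := fun k => by
      rw [← (opEntry_self_eq_ofReal e hT k).1]
      exact apply_eq_opEntry_smul e (by simpa [e] using he' k.down)
    let _ : MeasurableSpace (ULift.{w} (Fin (Module.finrank ℂ H))) := ⊤
    have : MeasurableSingletonClass (ULift.{w} (Fin (Module.finrank ℂ H))) := ⟨fun _ => trivial⟩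
    refine le_iSup_of_le (ULift.{w} (Fin (Module.finrank ℂ H))) (le_iSup_of_le inferInstance
      (le_iSup_of_le (basisPOVM e) ?_))
    refine le_trans (le_of_eq ?_) (hF.le_erealIntegral (t := fun k => (opEntry e T k k).re)
      (Measure.absolutelyContinuous_of_le (Measure.le_add_right le_rfl))
      (Measure.absolutelyContinuous_of_le (Measure.le_add_left le_rfl))
      (fun k => (opEntry_self_eq_ofReal e hT k).2) fun k => ?_)
    · congr 1
      rw [trRe, LinearMap.trace_eq_sum_inner _ e, Complex.re_sum, Finset.mul_sum]
      refine Finset.sum_congr rfl fun k _ => ?_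
      rw [outcome_basisPOVM_real_singleton, ContinuousLinearMap.coe_coe, mul_apply_eq_comp,
        pow_two, mul_apply_eq_comp, he, map_smul, he, map_smul, map_smul, inner_smul_right,
        inner_smul_right, Complex.re_ofReal_mul, Complex.re_ofReal_mul,
        show inner ℂ (e k) (ρ₂ (e k)) = opEntry e ρ₂ k k from rfl]
      ring
    · rw [outcome_basisPOVM_real_singleton, outcome_basisPOVM_real_singleton]
      -- The diagonal of the Lyapunov equation in an eigenbasis of `T` is the required relation
      -- `2P₁{k} = t_k P₂{k}`.
      have h4 : opEntry e ρ₁ k k = ((1 / 4 : ℝ) : ℂ) *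
          (((opEntry e T k k).re : ℂ) * opEntry e ρ₂ k k +
            ((opEntry e T k k).re : ℂ) * opEntry e ρ₂ k k) := by
        have hl : inner ℂ (e k) (T (ρ₂ (e k))) =
            ((opEntry e T k k).re : ℂ) * opEntry e ρ₂ k k := by
          rw [← hT.inner_left_eq_inner_right, he, inner_smul_left, Complex.conj_ofReal]
          rfl
        have hr : inner ℂ (e k) (ρ₂ (T (e k))) =
            ((opEntry e T k k).re : ℂ) * opEntry e ρ₂ k k := by
          rw [he, map_smul, inner_smul_right]
          rfl
        conv_lhs => rw [opEntry, ← h, ← Complex.coe_smul]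
        rw [smul_apply, add_apply, mul_apply_eq_comp, mul_apply_eq_comp, inner_smul_right,
          inner_add_right, hl, hr]
      rw [h4, Complex.re_ofReal_mul, Complex.add_re, Complex.re_ofReal_mul]
      ring

theorem measuredDiv_renyiFun_two_eq (h₁ : ρ₁.IsPositive) (h₂ : ρ₂.IsPositive) (hT : T.IsPositive)
    (h : (1 / 4 : ℝ) • (T * ρ₂ + ρ₂ * T) = ρ₁) :
    measuredDiv.{u, w} (renyiFun 2) ρ₁ ρ₂ h₁ h₂ = ((1 / 4 * trRe (ρ₂ * T ^ 2) : ℝ) : EReal) :=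
  iSup_erealIntegral_outcome_eq isQuadraticKernel_renyiFun_two h₁ h₂ hT h

theorem measuredDiv_renyiFun_neg_one_eq (h₁ : ρ₁.IsPositive) (h₂ : ρ₂.IsPositive)
    (hT : T.IsPositive) (h : (1 / 4 : ℝ) • (T * ρ₂ + ρ₂ * T) = ρ₁) :
    measuredDiv.{u, w} (renyiFun (-1)) ρ₂ ρ₁ h₂ h₁ =
      ((1 / 4 * trRe (ρ₂ * T ^ 2) : ℝ) : EReal) := by
  rw [← iSup_erealIntegral_outcome_eq.{u, w} isQuadraticKernel_renyiFun_neg_one h₁ h₂ hT h]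
  refine iSup_congr fun Ω => iSup_congr fun _ => iSup_congr fun M => ?_
  -- The swapped divergence differs only in the order of the summands of the dominating measure.
  rw [fDivergence, add_comm]

/-! ### The dual problem and the main theorem -/

/-- The gap between the two sides is `¼ tr ρ₂(S - T)²`, a trace of a product of positive operators.
-/
theorem dualObjective_le_of_lyapunov (h₂ : ρ₂.IsPositive) (hT : T.IsPositive)
    (h : (1 / 4 : ℝ) • (T * ρ₂ + ρ₂ * T) = ρ₁) {S : H →L[ℂ] H}
    (hS : S ∈ dualDomain (renyiFun 2)) :
    dualObjective (renyiFun 2) ρ₁ ρ₂ S ≤ 1 / 4 * trRe (ρ₂ * T ^ 2) := by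
  have : CompleteSpace H := FiniteDimensional.complete ℂ H
  have hST : IsSelfAdjoint (S - T) := (mem_dualDomain_renyiFun_two.1 hS).1.sub hT.isSelfAdjoint
  have hpos := ContinuousLinearMap.isPositive_self_comp_adjoint (S - T)
  rw [ContinuousLinearMap.isSelfAdjoint_iff'.1 hST] at hpos
  have hnn := trRe_mul_nonneg h₂ hpos
  have hexp : ρ₂ * ((S - T) ∘L (S - T)) =
      ρ₂ * S ^ 2 - ρ₂ * (S * T) - (ρ₂ * (T * S) - ρ₂ * T ^ 2) := by
    change ρ₂ * ((S - T) * (S - T)) = _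
    noncomm_ring
  rw [hexp, trRe_sub, trRe_sub, trRe_sub] at hnn
  rw [dualObjective_renyiFun_two hS, trRe_mul_eq_of_lyapunov h]
  linarith

end Measurements

theorem mainTheorem8 {H : Type u} [NormedAddCommGroup H] [InnerProductSpace ℂ H]
    [FiniteDimensional ℂ H] (ρ₁ ρ₂ : H →L[ℂ] H) (h₁ : ρ₁.IsPositive) (h₂ : ρ₂.IsPositive)
    (hsupp : opSupport ρ₁ ≤ opSupport ρ₂) :
    -- the integral defining `T₀` converges, and `T₀` solves the Lyapunov equation
    IntegrableOn (lyapIntegrand ρ₁ ρ₂) (Set.Iic (0 : ℝ)) ∧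
    (lyapOp ρ₁ ρ₂).IsPositive ∧
    (1 / 4 : ℂ) • (lyapOp ρ₁ ρ₂ * ρ₂ + ρ₂ * lyapOp ρ₁ ρ₂) = ρ₁ ∧
    -- `T₀` is an optimizer, and the optimal value is the measured divergence
    lyapOp ρ₁ ρ₂ ∈ dualDomain (renyiFun 2) ∧
    (∀ T ∈ dualDomain (renyiFun 2), dualObjective (renyiFun 2) ρ₁ ρ₂ T ≤
      dualObjective (renyiFun 2) ρ₁ ρ₂ (lyapOp ρ₁ ρ₂)) ∧
    measuredDiv.{u, w} (renyiFun 2) ρ₁ ρ₂ h₁ h₂ =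
      (dualObjective (renyiFun 2) ρ₁ ρ₂ (lyapOp ρ₁ ρ₂) : EReal) ∧
    -- the closed formulas
    measuredDiv.{u, w} (renyiFun (-1)) ρ₂ ρ₁ h₂ h₁ = measuredDiv.{u, w} (renyiFun 2) ρ₁ ρ₂ h₁ h₂ ∧
    measuredDiv.{u, w} (renyiFun 2) ρ₁ ρ₂ h₁ h₂ =
      ((1 / 4 * trRe (ρ₂ * lyapOp ρ₁ ρ₂ ^ 2) : ℝ) : EReal) ∧
    measuredDiv.{u, w} (renyiFun 2) ρ₁ ρ₂ h₁ h₂ =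
      ((1 / 2 * trRe (ρ₁ * lyapOp ρ₁ ρ₂) : ℝ) : EReal) ∧
    -- the formulas in an arbitrary orthonormal eigenbasis of `ρ₂`
    ∀ (ι : Type v) [Fintype ι] (e : OrthonormalBasis ι ℂ H),
      (∀ i, ∃ c : ℂ, ρ₂ (e i) = c • e i) →
      (∀ i j, opEntry e (lyapOp ρ₁ ρ₂) i j =
        4 / (opEntry e ρ₂ i i + opEntry e ρ₂ j j) * opEntry e ρ₁ i j) ∧
      measuredDiv.{u, w} (renyiFun 2) ρ₁ ρ₂ h₁ h₂ =
        ((2 * ∑ i, ∑ j, ‖opEntry e ρ₁ i j‖ ^ 2 /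
          ((opEntry e ρ₂ i i).re + (opEntry e ρ₂ j j).re) : ℝ) : EReal) := by
  have hT := lyapOp_isPositive h₁ h₂ hsupp
  have hlyap := lyapOp_lyapunov h₂ hsupp
  have hlyap' : (1 / 4 : ℝ) • (lyapOp ρ₁ ρ₂ * ρ₂ + ρ₂ * lyapOp ρ₁ ρ₂) = ρ₁ := by
    rw [← Complex.coe_smul]
    simpa using hlyap
  have htr := trRe_mul_eq_of_lyapunov hlyap' (lyapOp ρ₁ ρ₂)
  rw [← pow_two] at htr
  have hdom := mem_dualDomain_of_isPositive hT
  have hobj : dualObjective (renyiFun 2) ρ₁ ρ₂ (lyapOp ρ₁ ρ₂) =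
      1 / 4 * trRe (ρ₂ * lyapOp ρ₁ ρ₂ ^ 2) := by
    rw [dualObjective_renyiFun_two hdom, htr]
    ring
  have hhalf : 1 / 4 * trRe (ρ₂ * lyapOp ρ₁ ρ₂ ^ 2) = 1 / 2 * trRe (ρ₁ * lyapOp ρ₁ ρ₂) := by
    rw [htr]
    ring
  have hdiv := measuredDiv_renyiFun_two_eq.{u, w} h₁ h₂ hT hlyap'
  refine ⟨integrableOn_lyapIntegrand h₂ hsupp, hT, hlyap, hdom,
    fun S hS => hobj ▸ dualObjective_le_of_lyapunov h₂ hT hlyap' hS, by rw [hobj, hdiv],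
    by rw [hdiv, measuredDiv_renyiFun_neg_one_eq h₁ h₂ hT hlyap'], hdiv, by rw [hdiv, hhalf],
    fun ι _ e he => ⟨opEntry_lyapOp h₂ hsupp e he, ?_⟩⟩
  rw [hdiv, hhalf, trRe_mul_lyapOp_eq_sum h₁ h₂ hsupp e he]
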